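/- Consider the uplink of a cell-free network with $K\ge 1$ single-antenna UEs and $L$ APs with $N$ antennas each. On a probability space let $\mathbf h_{il}\in\mathbb C^N$ (channel of UE $i$ to AP $l$) and $\mathbf v_{kl}\in\mathbb C^N$ (local combiner for UE $k$ at AP $l$) be random vectors, let $\mathcal M_k\subseteq\{1,\dots,L\}$ be the set of APs serving UE $k$, let $\sigma^2>0$ be the noise variance and $\rho_u>0$ the maximum power. Put $$\mathbf g_{ki}=\big(\mathbf v_{kl}^{H}\mathbf h_{il}\big)_{l\in\mathcal M_k},\qquad \mathbf F_k=\mathrm{diag}\big(\sigma^2\,\mathbb E\{\|\mathbf v_{kl}\|^2\}\big)_{l\in\mathcal M_k},$$ $$\mathbf C_k(\eta)=\sum_{i=1}^K\eta_i\,\mathbb E\{\mathbf g_{ki}\mathbf g_{ki}^H\}-\eta_k\,\mathbb E\{\mathbf g_{kk}\}\mathbb E\{\mathbf g_{kk}\}^H+\mathbf F_k .$$ Assume that for all $k,i$ and all $l\in\mathcal M_k$ the variables $\|\mathbf v_{kl}\|$ and $\mathbf v_{kl}^H\mathbf h_{il}$ have finite second moments, that $\mathbf v_{kl}$ is not almost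 surely zero, and that $\mathbb E\{\mathbf g_{kk}\}\neq\mathbf 0$. The SINR of UE $k$ with powers $\eta$ and LSFD (large-scale fading decoding) vector $\mathbf a_k\in\mathbb C^{|\mathcal M_k|}$ is $$\mathrm{SINR}_k(\eta,\mathbf a_k)=\frac{\eta_k|\mathbf a_k^H\mathbb E\{\mathbf g_{kk}\}|^2}{\mathbf a_k^H\mathbf C_k(\eta)\mathbf a_k}$$ (read as $0$ for $\mathbf a_k=\mathbf 0$); with the optimal LSFD vector $\mathbf a_k^{\rm opt}(\eta)=\mathbf C_k(\eta)^{-1}\mathbb E\{\mathbf g_{kk}\}$ it equals $\mathrm{SINR}^{\rm opt}_k(\eta)=\eta_k\,\mathbb E\{\mathbf g_{kk}\}^H\mathbf C_k(\eta)^{-1}\mathbb E\{\mathbf g_{kk}\}$. From initial powers $\eta^{(0)}$ the fixed-point algorithm computes, for $j=1,2,\dots$, $$\tilde\eta_k^{(j)}=\frac{1}{\mathbb E\{\mathbf g_{kk}\}^H\,\mathbf C_k(\eta^{(j-1)})^{-1}\,\mathbb E\{\mathbf g_{kk}\}},\qquad \eta_k^{(j)}=\frac{\rho_u}{\max_i\tilde\eta_i^{(j)}}\,\tilde\eta_k^{(j)},\qquad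 k=1,\dots,K.$$ Then there is a power vector $\eta^\star$ that is a global optimum of $$\max_{\eta}\ \min_k\ \mathrm{SINR}_k^{\rm opt}(\eta)\quad\text{subject to}\quad 0\le\eta_k\le\rho_u,\ k=1,\dots,K,$$ such that $(\eta^\star,(\mathbf a_k^{\rm opt}(\eta^\star))_k)$ maximizes $\min_k\mathrm{SINR}_k(\eta,\mathbf a_k)$ jointly over all powers with $0\le\eta_k\le\rho_u$ and all LSFD vectors, and such that $\eta^{(j)}\to\eta^\star$ as $j\to\infty$ for every choice of initial powers with $\eta_k^{(0)}>0$ for all $k$. -/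

import Mathlib

open MeasureTheory Filter Topology
open scoped Matrix

noncomputable section

/-- Uplink of a user-centric cell-free network with `K` single-antenna UEs and `L` APs with `N`
antennas each. The channels and the local combiners are random vectors on `Ω`; no particular
distribution is imposed (correlated Rayleigh fading, with combiners computed from local channel
estimates, is a special case). -/
structure CellFree (K L N : ℕ) (Ω : Type*) where
  /-- `h k l` is the channel between UE `k` and AP `l`. -/
  h : Fin K → Fin L → Ω → EuclideanSpace ℂ (Fin N)
  /-- `v k l` is the local receive combiner for UE `k` at AP `l` (used only if `l ∈ M k`). -/
  v : Fin K → Fin L → Ω → EuclideanSpace ℂ (Fin N)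
  /-- `M k` is the set of APs that serve UE `k`. -/
  M : Fin K → Finset (Fin L)
  /-- `σ ^ 2` is the receiver noise variance. -/
  σ : ℝ

namespace CellFree

variable {K L N : ℕ} {Ω : Type*} [MeasurableSpace Ω]

/-- The receive-combined channel `g_ki`, with entries `v_kl^H h_il` for `l ∈ M k`
(the inner product is conjugate-linear in its first argument). -/
def g (S : CellFree K L N Ω) (k i : Fin K) (ω : Ω) : S.M k → ℂ :=
  fun l => inner ℂ (S.v k l ω) (S.h i l ω)

/-- `E{g_kk}`. -/
def meanG (S : CellFree K L N Ω) (P : Measure Ω) (k : Fin K) : S.M k → ℂ :=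
  fun l => ∫ ω, S.g k k ω l ∂P

/-- `E{g_ki g_ki^H}`. -/
def corrG (S : CellFree K L N Ω) (P : Measure Ω) (k i : Fin K) : Matrix (S.M k) (S.M k) ℂ :=
  Matrix.of fun l m => ∫ ω, S.g k i ω l * star (S.g k i ω m) ∂P

/-- The effective noise matrix `F_k = diag(σ² E‖v_kl‖² : l ∈ M k)`. -/
def noiseMat (S : CellFree K L N Ω) (P : Measure Ω) (k : Fin K) : Matrix (S.M k) (S.M k) ℂ :=
  Matrix.diagonal fun l => ((S.σ ^ 2 * ∫ ω, ‖S.v k l ω‖ ^ 2 ∂P : ℝ) : ℂ)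

/-- `C_k(η) = ∑ i, η_i E{g_ki g_ki^H} - η_k E{g_kk} E{g_kk}^H + F_k`. -/
def C (S : CellFree K L N Ω) (P : Measure Ω) (η : Fin K → ℝ) (k : Fin K) :
    Matrix (S.M k) (S.M k) ℂ :=
  (∑ i, (η i : ℂ) • S.corrG P k i)
    - (η k : ℂ) • Matrix.vecMulVec (S.meanG P k) (star (S.meanG P k))
    + S.noiseMat P k

/-- The effective SINR of UE `k` with powers `η` and LSFD weight vector `a`:
`η_k |a^H E{g_kk}|² / (a^H C_k(η) a)`. -/
def sinr (S : CellFree K L N Ω) (P : Measure Ω) (η : Fin K → ℝ) (k : Fin K)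
    (a : S.M k → ℂ) : ℝ :=
  η k * ‖star a ⬝ᵥ S.meanG P k‖ ^ 2 / (star a ⬝ᵥ (S.C P η k *ᵥ a)).re

/-- The optimal LSFD vector `C_k(η)⁻¹ E{g_kk}`. -/
def optLSFD (S : CellFree K L N Ω) (P : Measure Ω) (η : Fin K → ℝ) (k : Fin K) : S.M k → ℂ :=
  (S.C P η k)⁻¹ *ᵥ S.meanG P k

/-- The real number `E{g_kk}^H C_k(η)⁻¹ E{g_kk}`. -/
def gain (S : CellFree K L N Ω) (P : Measure Ω) (η : Fin K → ℝ) (k : Fin K) : ℝ :=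
  (star (S.meanG P k) ⬝ᵥ ((S.C P η k)⁻¹ *ᵥ S.meanG P k)).re

/-- The SINR with the optimal LSFD: `η_k E{g_kk}^H C_k(η)⁻¹ E{g_kk}`. -/
def sinrOpt (S : CellFree K L N Ω) (P : Measure Ω) (η : Fin K → ℝ) (k : Fin K) : ℝ :=
  η k * S.gain P η k

/-- The powers allowed by the per-UE constraints `0 ≤ η_k ≤ ρ`. -/
def feasible (K : ℕ) (ρ : ℝ) : Set (Fin K → ℝ) := {η | ∀ k, 0 ≤ η k ∧ η k ≤ ρ}

/-- `min_k x_k`. -/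
def minUE [NeZero K] (x : Fin K → ℝ) : ℝ := Finset.univ.inf' Finset.univ_nonempty x

/-- `max_k x_k`. -/
def maxUE [NeZero K] (x : Fin K → ℝ) : ℝ := Finset.univ.sup' Finset.univ_nonempty x

/-- The power update `η_k ← 1 / (E{g_kk}^H C_k(η)⁻¹ E{g_kk})`. -/
def update (S : CellFree K L N Ω) (P : Measure Ω) (η : Fin K → ℝ) : Fin K → ℝ :=
  fun k => 1 / S.gain P η k

/-- The rescaling `η_k ← (ρ / max_i η_i) η_k`. -/
def rescale [NeZero K] (ρ : ℝ) (η : Fin K → ℝ) : Fin K → ℝ :=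
  fun k => ρ / maxUE η * η k

/-- The powers after `j` iterations of the fixed-point algorithm started at `η₀`. -/
def iterate [NeZero K] (S : CellFree K L N Ω) (P : Measure Ω) (ρ : ℝ) (η₀ : Fin K → ℝ) :
    ℕ → Fin K → ℝ
  | 0 => η₀
  | j + 1 => rescale ρ (S.update P (S.iterate P ρ η₀ j))

end CellFree

end

/-!
By the Cauchy–Schwarz inequality for the form of `C_k(η)`, the update `1 / (m^H C_k(η)⁻¹ m)` with
`m = E{g_kk}` is the minimum of `a^H C_k(η) a` over the vectors with `a^H m = 1`. Since `C_k(η)` is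
affine in `η` with positive semidefinite coefficients and positive definite at `η = 0`, the update
`T` is a monotone concave map that is positive at the origin. On bounded sets such a map satisfies
`δ T η ≤ T 0` for some `δ > 0`, so concavity makes it a contraction of Hilbert's projective metric
with factor `1 - δ`; rescaling does not change that metric, and Banach's fixed point theorem gives a
globally attracting fixed point `z` of the normalized iteration.

At `z` all ratios `z_k / T_k z = SINR_k^opt(z)` are equal. If every ratio at a feasible `η` were
larger, comparing `z` with the least multiple of `η` that dominates it would contradict monotonicity
and concavity.
-/

section HilbertMetric

variable {ι : Type*} [Fintype ι] {x y z : ι → ℝ}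

/-- Hilbert's projective metric `log (max_i (x_i / y_i) * max_i (y_i / x_i))` on the vectors with
positive entries; the two maxima are sup norms. -/
noncomputable def hilbertDist (x y : ι → ℝ) : ℝ := Real.log (‖x / y‖ * ‖y / x‖)

lemma hilbertDist_smul_smul {c d : ℝ} (hc : c ≠ 0) (hd : d ≠ 0) (x y : ι → ℝ) :
    hilbertDist (c • x) (d • y) = hilbertDist x y := by
  have smul_div_smul (a b : ℝ) (u v : ι → ℝ) : (a • u) / (b • v) = (a / b) • (u / v) :=
    funext fun i => mul_div_mul_comm a (u i) b (v i)
  have hcd : ‖c / d‖ * ‖d / c‖ = 1 := by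
    rw [← norm_mul, div_mul_div_cancel₀ hd, div_self hc, norm_one]
  rw [hilbertDist, smul_div_smul, smul_div_smul, norm_smul, norm_smul, mul_mul_mul_comm, hcd,
    one_mul, hilbertDist]

lemma le_norm_div_smul (x : ι → ℝ) (hy : ∀ i, 0 < y i) : x ≤ ‖x / y‖ • y := fun i =>
  (div_le_iff₀ (hy i)).1 <| (le_abs_self _).trans <| norm_le_pi_norm (x / y) i

lemma norm_div_le_of_le_smul (hx : 0 ≤ x) (hy : ∀ i, 0 < y i) {c : ℝ} (hc : 0 ≤ c)
    (h : x ≤ c • y) : ‖x / y‖ ≤ c := by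
  refine (pi_norm_le_iff_of_nonneg hc).2 fun i => ?_
  rw [Pi.div_apply, Real.norm_of_nonneg (div_nonneg (hx i) (hy i).le), div_le_iff₀ (hy i)]
  exact h i

lemma one_le_norm_div (hy : ∀ i, 0 < y i) (hx : 0 < ‖x‖) (hyx : ‖y‖ ≤ ‖x‖) : 1 ≤ ‖x / y‖ := by
  have hmul : x / y * y = x := funext fun i => div_mul_cancel₀ (x i) (hy i).ne'
  have hle : ‖x‖ ≤ ‖x / y‖ * ‖x‖ := calc
    ‖x‖ ≤ ‖x / y‖ * ‖y‖ := by simpa only [hmul] using norm_mul_le (x / y) y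
    _ ≤ ‖x / y‖ * ‖x‖ := by gcongr
  exact (le_mul_iff_one_le_left hx).1 hle

lemma hilbertDist_comm (x y : ι → ℝ) : hilbertDist x y = hilbertDist y x := by
  rw [hilbertDist, mul_comm, hilbertDist]

lemma hilbertDist_iterate_le {f : (ι → ℝ) → ι → ℝ} {s : Set (ι → ℝ)} {r : ℝ}
    (hmaps : Set.MapsTo f s s) (hr : 0 ≤ r)
    (hf : ∀ x ∈ s, ∀ y ∈ s, hilbertDist (f x) (f y) ≤ r * hilbertDist x y)
    (hx : x ∈ s) (hy : y ∈ s) (n : ℕ) :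
    hilbertDist (f^[n] x) (f^[n] y) ≤ r ^ n * hilbertDist x y := by
  induction n with
  | zero => simp
  | succ n ih =>
    rw [Function.iterate_succ_apply', Function.iterate_succ_apply', pow_succ', mul_assoc]
    exact (hf _ (hmaps.iterate n hx) _ (hmaps.iterate n hy)).trans (by gcongr)

variable [Nonempty ι]

lemma norm_pos_of_forall_pos (hx : ∀ i, 0 < x i) : 0 < ‖x‖ :=
  norm_pos_iff.2 <| Function.ne_iff.2 <| ‹Nonempty ι›.elim fun i => ⟨i, (hx i).ne'⟩

lemma dist_le_norm_mul_hilbertDist (hx : ∀ i, 0 < x i) (hy : ∀ i, 0 < y i) (hxy : ‖x‖ = ‖y‖) :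
    dist x y ≤ ‖x‖ * hilbertDist x y := by
  have sub_le {u v : ι → ℝ} (hu : ∀ i, 0 < u i) (hv : ∀ i, 0 < v i) (huv : ‖u‖ = ‖v‖) (i : ι) :
      u i - v i ≤ ‖u‖ * hilbertDist u v := by
    have h₁ : 1 ≤ ‖u / v‖ := one_le_norm_div hv (norm_pos_of_forall_pos hu) huv.ge
    have h₂ : 1 ≤ ‖v / u‖ := one_le_norm_div hu (norm_pos_of_forall_pos hv) huv.le
    have hratio : u i * ‖u / v‖⁻¹ ≤ v i := by
      rw [← div_eq_mul_inv, div_le_iff₀' (by positivity)]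
      exact le_norm_div_smul u hv i
    have hlog : 1 - ‖u / v‖⁻¹ ≤ hilbertDist u v :=
      (Real.one_sub_inv_le_log_of_pos (by positivity)).trans <|
        Real.log_le_log (by positivity) (le_mul_of_one_le_right (by positivity) h₂)
    calc u i - v i ≤ u i * (1 - ‖u / v‖⁻¹) := by linarith
      _ ≤ ‖u‖ * hilbertDist u v := by
        gcongr
        · exact sub_nonneg.2 (inv_le_one_of_one_le₀ h₁)
        · exact (le_abs_self _).trans (norm_le_pi_norm u i)
  refine dist_pi_le_iff'.2 fun i => abs_sub_le_iff.2 ⟨sub_le hx hy hxy i, ?_⟩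
  rw [hxy, hilbertDist_comm]
  exact sub_le hy hx hxy.symm i

lemma tendsto_hilbertDist_self {α : Type*} {l : Filter α} {u : α → ι → ℝ} (hz : ∀ i, 0 < z i)
    (hu : Tendsto u l (𝓝 z)) : Tendsto (fun a => hilbertDist (u a) z) l (𝓝 0) := by
  have hself : z / z = 1 := funext fun i => div_self (hz i).ne'
  have hdiv : Tendsto (fun a => u a / z) l (𝓝 1) := by
    refine hself ▸ tendsto_pi_nhds.2 fun i => (tendsto_pi_nhds.1 hu i).div_const (z i)
  have hdiv' : Tendsto (fun a => z / u a) l (𝓝 1) := by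
    refine hself ▸ tendsto_pi_nhds.2 fun i =>
      tendsto_const_nhds.div (tendsto_pi_nhds.1 hu i) (hz i).ne'
  have hmul : Tendsto (fun a => ‖u a / z‖ * ‖z / u a‖) l (𝓝 1) := by
    simpa using hdiv.norm.mul hdiv'.norm
  simpa [hilbertDist] using hmul.log one_ne_zero

theorem exists_fixedPoint_of_hilbertDist_le {f : (ι → ℝ) → ι → ℝ} {s : Set (ι → ℝ)} {ρ r : ℝ}
    (hs : IsClosed s) (hne : s.Nonempty) (hpos : ∀ x ∈ s, ∀ i, 0 < x i)
    (hnorm : ∀ x ∈ s, ‖x‖ = ρ) (hmaps : Set.MapsTo f s s) (hr₀ : 0 ≤ r) (hr₁ : r < 1)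
    (hf : ∀ x ∈ s, ∀ y ∈ s, hilbertDist (f x) (f y) ≤ r * hilbertDist x y) :
    ∃ z ∈ s, f z = z ∧ ∀ x ∈ s, Tendsto (fun n => f^[n] x) atTop (𝓝 z) := by
  have hmem (n : ℕ) {x} (hx : x ∈ s) : f^[n] x ∈ s := hmaps.iterate n hx
  have dist_le {x y} (hx : x ∈ s) (hy : y ∈ s) : dist x y ≤ ρ * hilbertDist x y :=
    hnorm x hx ▸ dist_le_norm_mul_hilbertDist (hpos x hx) (hpos y hy)
      ((hnorm x hx).trans (hnorm y hy).symm)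
  have hρ : 0 ≤ ρ := hnorm _ hne.some_mem ▸ norm_nonneg _
  have hdist (n : ℕ) {x y} (hx : x ∈ s) (hy : y ∈ s) :
      dist (f^[n] x) (f^[n] y) ≤ ρ * hilbertDist x y * r ^ n :=
    (dist_le (hmem n hx) (hmem n hy)).trans <| by
      rw [mul_assoc, mul_comm (hilbertDist x y)]
      gcongr
      exact hilbertDist_iterate_le hmaps hr₀ hf hx hy n
  obtain ⟨w, hw⟩ := hne
  obtain ⟨z, hzs, hz⟩ := cauchySeq_tendsto_of_isComplete hs.isComplete (fun n => hmem n hw)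
    (cauchySeq_of_le_geometric r _ hr₁ fun n => hdist n hw (hmaps hw))
  have hcont : Tendsto (fun n => f (f^[n] w)) atTop (𝓝 (f z)) := by
    refine tendsto_iff_dist_tendsto_zero.2 <| squeeze_zero (fun _ => dist_nonneg)
      (fun n => (dist_le (hmaps (hmem n hw)) (hmaps hzs)).trans <|
        mul_le_mul_of_nonneg_left (hf _ (hmem n hw) z hzs) hρ) ?_
    simpa using ((tendsto_hilbertDist_self (hpos z hzs) hz).const_mul r).const_mul ρ
  have hfix : f z = z := tendsto_nhds_unique hcont <| by
    simpa only [Function.comp_def, Function.iterate_succ_apply'] using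
      hz.comp (tendsto_add_atTop_nat 1)
  refine ⟨z, hzs, hfix, fun x hx => tendsto_iff_dist_tendsto_zero.2 <|
    squeeze_zero (fun _ => dist_nonneg) (fun n => ?_) <| by
      simpa using (tendsto_pow_atTop_nhds_zero_of_lt_one hr₀ hr₁).const_mul (ρ * hilbertDist x z)⟩
  simpa only [Function.iterate_fixed hfix] using hdist n hx hzs

end HilbertMetric

section ConcaveInterference

variable {ι : Type*}

/-- Concave interference functions in the sense of Yates: monotone concave maps on the nonnegative
orthant that are positive at the origin. -/
structure IsConcaveInterference (T : (ι → ℝ) → ι → ℝ) : Prop where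
  monotoneOn : MonotoneOn T (Set.Ici 0)
  concaveOn : ConcaveOn ℝ (Set.Ici 0) T
  zero_pos : ∀ i, 0 < T 0 i

namespace IsConcaveInterference

open NormedSpace (normalize norm_normalize)

variable {T : (ι → ℝ) → ι → ℝ} {x y z : ι → ℝ} {c δ ρ : ℝ}

lemma apply_pos (hT : IsConcaveInterference T) (hx : 0 ≤ x) (i : ι) : 0 < T x i :=
  (hT.zero_pos i).trans_le (hT.monotoneOn (Set.mem_Ici.2 le_rfl) hx hx i)

lemma add_mul_apply_zero_le (hT : IsConcaveInterference T) (hx : 0 ≤ x) (hy : 0 ≤ y) (hc : 1 ≤ c)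
    (h : x ≤ c • y) (i : ι) : T x i + (c - 1) * T 0 i ≤ c * T y i := by
  have hc₀ : 0 < c := one_pos.trans_le hc
  have hcx : c⁻¹ • x ≤ y := (inv_smul_le_iff_of_pos hc₀).2 h
  have hconc : c⁻¹ * T x i + (1 - c⁻¹) * T 0 i ≤ T (c⁻¹ • x) i := by
    simpa using hT.concaveOn.2 hx (Set.mem_Ici.2 le_rfl) (inv_nonneg.2 hc₀.le)
      (sub_nonneg.2 (inv_le_one_of_one_le₀ hc)) (add_sub_cancel _ _) i
  calc T x i + (c - 1) * T 0 i = c * (c⁻¹ * T x i + (1 - c⁻¹) * T 0 i) := by field_simp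
    _ ≤ c * T y i := by
      gcongr
      exact hconc.trans (hT.monotoneOn (smul_nonneg (inv_nonneg.2 hc₀.le) hx) hy hcx i)

-- Bernoulli's inequality `c ^ δ ≤ 1 + δ * (c - 1)` turns the additive gain into a power saving.
lemma apply_le_rpow_smul (hT : IsConcaveInterference T) (hx : 0 ≤ x) (hy : 0 ≤ y) (hc : 1 ≤ c)
    (h : x ≤ c • y) (hδ₀ : 0 ≤ δ) (hδ₁ : δ ≤ 1) (hδ : δ • T x ≤ T 0) :
    T x ≤ c ^ (1 - δ) • T y := fun i => by
  have hc₀ : 0 < c := one_pos.trans_le hc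
  have bernoulli : c ^ δ ≤ 1 + δ * (c - 1) := by
    simpa using rpow_one_add_le_one_add_mul_self (by linarith : -1 ≤ c - 1) hδ₀ hδ₁
  have key : c ^ δ * T x i ≤ c * T y i :=
    calc c ^ δ * T x i ≤ (1 + δ * (c - 1)) * T x i := by
          gcongr
          exact (hT.apply_pos hx i).le
      _ = T x i + (c - 1) * (δ * T x i) := by ring
      _ ≤ T x i + (c - 1) * T 0 i := by
          gcongr
          exact hδ i
      _ ≤ c * T y i := hT.add_mul_apply_zero_le hx hy hc h i
  rw [Pi.smul_apply, smul_eq_mul, Real.rpow_sub hc₀, Real.rpow_one, div_mul_eq_mul_div,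
    le_div_iff₀' (Real.rpow_pos_of_pos hc₀ δ)]
  exact key

variable [Fintype ι]

lemma normalize_apply_nonneg (hT : IsConcaveInterference T) (hρ : 0 ≤ ρ) (hx : 0 ≤ x) :
    0 ≤ ρ • normalize (T x) :=
  smul_nonneg hρ <| smul_nonneg (by positivity) fun i => (hT.apply_pos hx i).le

lemma div_apply_of_normalize_eq (hT : IsConcaveInterference T) (hz : 0 ≤ z)
    (hfix : ρ • normalize (T z) = z) (i : ι) : z i / T z i = ρ / ‖T z‖ := by
  rw [div_eq_iff (hT.apply_pos hz i).ne', div_eq_mul_inv, mul_assoc]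
  exact (congrFun hfix i).symm

variable [Nonempty ι]

lemma norm_apply_pos (hT : IsConcaveInterference T) (hx : 0 ≤ x) : 0 < ‖T x‖ :=
  norm_pos_of_forall_pos (hT.apply_pos hx)

lemma exists_mul_norm_apply_le (hT : IsConcaveInterference T) (hρ : 0 ≤ ρ) :
    ∃ δ, 0 < δ ∧ ∀ x, 0 ≤ x → ‖x‖ ≤ ρ → ∀ i, δ * ‖T x‖ ≤ T 0 i := by
  obtain ⟨j, hj⟩ := Finite.exists_min (T 0)
  have hconst : (0 : ι → ℝ) ≤ fun _ => ρ := fun _ => hρ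
  have hT₀ := hT.norm_apply_pos hconst
  refine ⟨T 0 j / ‖T fun _ => ρ‖, div_pos (hT.zero_pos j) hT₀, fun x hx hxρ i => ?_⟩
  have hle : ‖T x‖ ≤ ‖T fun _ => ρ‖ := by
    refine (pi_norm_le_iff_of_nonneg (norm_nonneg _)).2 fun k => ?_
    rw [Real.norm_of_nonneg (hT.apply_pos hx k).le]
    have hxc : x ≤ fun _ => ρ := fun k =>
      (le_abs_self _).trans ((norm_le_pi_norm x k).trans hxρ)
    exact (hT.monotoneOn hx hconst hxc k).trans <|
      (le_abs_self _).trans (norm_le_pi_norm (T fun _ => ρ) k)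
  rw [div_mul_eq_mul_div, div_le_iff₀ hT₀]
  exact mul_le_mul (hj i) hle (norm_nonneg _) (hT.zero_pos i).le

lemma hilbertDist_apply_le (hT : IsConcaveInterference T) (hx : ∀ i, 0 < x i) (hy : ∀ i, 0 < y i)
    (hxy : ‖x‖ = ‖y‖) (hδ₀ : 0 ≤ δ) (hδ₁ : δ ≤ 1) (hδx : δ • T x ≤ T 0) (hδy : δ • T y ≤ T 0) :
    hilbertDist (T x) (T y) ≤ (1 - δ) * hilbertDist x y := by
  have ratio_le {u v : ι → ℝ} (hu : ∀ i, 0 < u i) (hv : ∀ i, 0 < v i) (huv : ‖u‖ = ‖v‖)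
      (hδu : δ • T u ≤ T 0) : ‖T u / T v‖ ≤ ‖u / v‖ ^ (1 - δ) :=
    have hu₀ : 0 ≤ u := fun i => (hu i).le
    have hv₀ : 0 ≤ v := fun i => (hv i).le
    norm_div_le_of_le_smul (fun i => (hT.apply_pos hu₀ i).le) (hT.apply_pos hv₀) (by positivity)
      (hT.apply_le_rpow_smul hu₀ hv₀ (one_le_norm_div hv (norm_pos_of_forall_pos hu) huv.ge)
        (le_norm_div_smul u hv) hδ₀ hδ₁ hδu)
  have ratio_pos {u v : ι → ℝ} (hu : ∀ i, 0 < u i) (hv : ∀ i, 0 < v i) : 0 < ‖u / v‖ :=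
    norm_pos_of_forall_pos fun i => div_pos (hu i) (hv i)
  have hTx := hT.apply_pos fun i => (hx i).le
  have hTy := hT.apply_pos fun i => (hy i).le
  have hpos := mul_pos (ratio_pos hx hy) (ratio_pos hy hx)
  rw [hilbertDist, hilbertDist, ← Real.log_rpow hpos, Real.mul_rpow (norm_nonneg _) (norm_nonneg _)]
  exact Real.log_le_log (mul_pos (ratio_pos hTx hTy) (ratio_pos hTy hTx)) <|
    mul_le_mul (ratio_le hx hy hxy hδx) (ratio_le hy hx hxy.symm hδy) (norm_nonneg _)
      (by positivity)

lemma norm_normalize_apply (hT : IsConcaveInterference T) (hρ : 0 ≤ ρ) (hx : 0 ≤ x) :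
    ‖ρ • normalize (T x)‖ = ρ := by
  rw [norm_smul, norm_normalize (norm_pos_iff.1 (hT.norm_apply_pos hx)), mul_one,
    Real.norm_of_nonneg hρ]

/-- Krause's nonlinear Perron–Frobenius theorem. -/
theorem exists_fixedPoint_normalize (hT : IsConcaveInterference T) (hρ : 0 < ρ) :
    ∃ z, 0 ≤ z ∧ ρ • normalize (T z) = z ∧
      ∀ x, 0 ≤ x → Tendsto (fun n => (fun u => ρ • normalize (T u))^[n] x) atTop (𝓝 z) := by
  set f : (ι → ℝ) → ι → ℝ := fun u => ρ • normalize (T u)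
  obtain ⟨δ, hδ₀, hδ⟩ := hT.exists_mul_norm_apply_le hρ.le
  let s : Set (ι → ℝ) := {x | ‖x‖ = ρ} ∩ Set.Ici fun _ => ρ * δ
  have hpos : ∀ x ∈ s, ∀ i, 0 < x i := fun x hx i => (mul_pos hρ hδ₀).trans_le (hx.2 i)
  have hnonneg : ∀ x ∈ s, 0 ≤ x := fun x hx i => (hpos x hx i).le
  have hf_mem {x} (hx : 0 ≤ x) (hxρ : ‖x‖ ≤ ρ) : f x ∈ s := by
    refine ⟨hT.norm_normalize_apply hρ.le hx, fun i => ?_⟩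
    refine mul_le_mul_of_nonneg_left ?_ hρ.le
    rw [NormedSpace.normalize, Pi.smul_apply, smul_eq_mul, ← div_eq_inv_mul,
      le_div_iff₀ (hT.norm_apply_pos hx)]
    exact (hδ x hx hxρ i).trans (hT.monotoneOn (Set.mem_Ici.2 le_rfl) hx hx i)
  have hf_ff {x} (hx : 0 ≤ x) : f (f x) ∈ s :=
    hf_mem (hT.normalize_apply_nonneg hρ.le hx) (hT.norm_normalize_apply hρ.le hx).le
  have hδT {x} (hx : 0 ≤ x) (hxρ : ‖x‖ ≤ ρ) : δ • T x ≤ T 0 := fun i =>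
    (mul_le_mul_of_nonneg_left ((le_abs_self _).trans (norm_le_pi_norm (T x) i)) hδ₀.le).trans
      (hδ x hx hxρ i)
  have hδ₁ : δ ≤ 1 := by
    obtain ⟨i⟩ := ‹Nonempty ι›
    exact (mul_le_iff_le_one_left (hT.zero_pos i)).1 (hδT le_rfl (by simpa using hρ.le) i)
  have hcontr : ∀ x ∈ s, ∀ y ∈ s, hilbertDist (f x) (f y) ≤ (1 - δ) * hilbertDist x y := by
    intro x hx y hy
    have hscale {u} (hu : u ∈ s) : ρ * ‖T u‖⁻¹ ≠ 0 :=
      (mul_pos hρ (inv_pos.2 (hT.norm_apply_pos (hnonneg u hu)))).ne'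
    simp only [f, NormedSpace.normalize, smul_smul]
    rw [hilbertDist_smul_smul (hscale hx) (hscale hy)]
    exact hT.hilbertDist_apply_le (hpos x hx) (hpos y hy) (hx.1.trans hy.1.symm) hδ₀.le hδ₁
      (hδT (hnonneg x hx) hx.1.le) (hδT (hnonneg y hy) hy.1.le)
  obtain ⟨z, hzs, hfix, hz⟩ := exists_fixedPoint_of_hilbertDist_le
    ((isClosed_eq continuous_norm continuous_const).inter isClosed_Ici) ⟨_, hf_ff le_rfl⟩ hpos
    (fun x hx => hx.1) (fun x hx => hf_mem (hnonneg x hx) hx.1.le) (sub_nonneg.2 hδ₁)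
    (sub_lt_self 1 hδ₀) hcontr
  exact ⟨z, hnonneg z hzs, hfix, fun x hx =>
    (tendsto_add_atTop_iff_nat 2).1 (hz _ (hf_ff hx))⟩

/-- The bound is the common value of the ratios `z i / T z i`, see `div_apply_of_normalize_eq`: the
fixed point is max-min optimal. -/
theorem exists_div_apply_le (hT : IsConcaveInterference T) (hρ : 0 < ρ) (hz : 0 ≤ z)
    (hfix : ρ • normalize (T z) = z) (hx : 0 ≤ x) (hxρ : ‖x‖ ≤ ρ) :
    ∃ i, x i / T x i ≤ ρ / ‖T z‖ := by
  by_contra! h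
  have hTx := hT.apply_pos hx
  have hc : 0 < ρ / ‖T z‖ := div_pos hρ (hT.norm_apply_pos hz)
  have hlt (i : ι) : ρ / ‖T z‖ * T x i < x i := (lt_div_iff₀ (hTx i)).1 (h i)
  have hx_pos (i : ι) : 0 < x i := (mul_pos hc (hTx i)).trans (hlt i)
  have hz_eq (i : ι) : z i = ρ / ‖T z‖ * T z i :=
    (div_eq_iff (hT.apply_pos hz i).ne').1 (hT.div_apply_of_normalize_eq hz hfix i)
  have hzρ : ‖z‖ = ρ := hfix ▸ hT.norm_normalize_apply hρ.le hz
  have hM : 1 ≤ ‖z / x‖ := one_le_norm_div hx_pos (hzρ ▸ hρ) (hxρ.trans hzρ.ge)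
  refine lt_irrefl ‖z / x‖ <| (pi_norm_lt_iff (by positivity)).2 fun i => ?_
  rw [Pi.div_apply, Real.norm_of_nonneg (div_nonneg (hz i) (hx i)), div_lt_iff₀ (hx_pos i)]
  calc z i = ρ / ‖T z‖ * T z i := hz_eq i
    _ ≤ ρ / ‖T z‖ * (‖z / x‖ * T x i) := by
      gcongr
      have hgain := hT.add_mul_apply_zero_le hz hx hM (le_norm_div_smul z hx_pos) i
      have := mul_nonneg (sub_nonneg.2 hM) (hT.zero_pos i).le
      linarith
    _ = ‖z / x‖ * (ρ / ‖T z‖ * T x i) := by ring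
    _ < ‖z / x‖ * x i := by
      gcongr
      exact hlt i

end IsConcaveInterference

end ConcaveInterference

section CaponPower

open scoped ComplexOrder

variable {𝕜 n : Type*} [RCLike 𝕜] [Fintype n] {a b : n → 𝕜} {C D : Matrix n n 𝕜}

lemma norm_star_dotProduct_mulVec_sq_le (hC : C.PosSemidef) (x y : n → 𝕜) :
    ‖star x ⬝ᵥ C *ᵥ y‖ ^ 2 ≤
      RCLike.re (star x ⬝ᵥ C *ᵥ x) * RCLike.re (star y ⬝ᵥ C *ᵥ y) := by
  let := C.toSeminormedAddCommGroup hC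
  let := C.toInnerProductSpace hC
  have inner_eq (x y : n → 𝕜) : inner 𝕜 x y = star x ⬝ᵥ C *ᵥ y := dotProduct_comm _ _
  rw [sq]
  nth_rw 2 [← inner_eq]
  rw [norm_inner_symm, inner_eq]
  simpa only [inner_eq] using inner_mul_inner_self_le (𝕜 := 𝕜) x y

variable [DecidableEq n]

lemma mulVec_inv_mulVec (hC : IsUnit C) (b : n → 𝕜) : C *ᵥ (C⁻¹ *ᵥ b) = b := by
  rw [Matrix.mulVec_mulVec, Matrix.mul_nonsing_inv _ (C.isUnit_iff_isUnit_det.1 hC),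
    Matrix.one_mulVec]

lemma star_inv_mulVec_dotProduct (hC : C.IsHermitian) (b : n → 𝕜) :
    star (C⁻¹ *ᵥ b) ⬝ᵥ b = (RCLike.re (star b ⬝ᵥ C⁻¹ *ᵥ b) : 𝕜) := by
  rw [Matrix.star_mulVec, hC.inv.eq, ← Matrix.dotProduct_mulVec]
  exact (RCLike.conj_eq_iff_re.1 <| RCLike.conj_eq_iff_im.2 <|
    hC.inv.im_star_dotProduct_mulVec_self b).symm

lemma norm_star_dotProduct_sq_le (hC : C.PosDef) (a b : n → 𝕜) :
    ‖star a ⬝ᵥ b‖ ^ 2 ≤ RCLike.re (star a ⬝ᵥ C *ᵥ a) * RCLike.re (star b ⬝ᵥ C⁻¹ *ᵥ b) := by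
  have h := norm_star_dotProduct_mulVec_sq_le hC.posSemidef a (C⁻¹ *ᵥ b)
  rwa [mulVec_inv_mulVec hC.isUnit, star_inv_mulVec_dotProduct hC.isHermitian,
    RCLike.ofReal_re] at h

/-- Capon's power estimate `1 / (b^H C⁻¹ b)`: the least output power of a combiner that passes the
signal direction `b` undistorted when the disturbance has covariance `C`, see
`isLeast_caponPower`. -/
noncomputable def caponPower (b : n → 𝕜) (C : Matrix n n 𝕜) : ℝ :=
  1 / RCLike.re (star b ⬝ᵥ C⁻¹ *ᵥ b)

lemma caponPower_pos (hC : C.PosDef) (hb : b ≠ 0) : 0 < caponPower b C :=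
  one_div_pos.2 (hC.inv.re_dotProduct_pos hb)

lemma caponPower_le (hC : C.PosDef) (hb : b ≠ 0) (ha : star a ⬝ᵥ b = 1) :
    caponPower b C ≤ RCLike.re (star a ⬝ᵥ C *ᵥ a) := by
  have h := norm_star_dotProduct_sq_le hC a b
  rw [ha, norm_one, one_pow] at h
  exact (div_le_iff₀ (hC.inv.re_dotProduct_pos hb)).2 h

lemma isLeast_caponPower (hC : C.PosDef) (hb : b ≠ 0) :
    IsLeast ((fun a => RCLike.re (star a ⬝ᵥ C *ᵥ a)) '' {a | star a ⬝ᵥ b = 1})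
      (caponPower b C) := by
  have hunit : star ((caponPower b C : 𝕜) • C⁻¹ *ᵥ b) ⬝ᵥ b = 1 := by
    rw [star_smul, smul_dotProduct, star_inv_mulVec_dotProduct hC.isHermitian, RCLike.star_def,
      RCLike.conj_ofReal, smul_eq_mul, ← RCLike.ofReal_mul, caponPower,
      one_div_mul_cancel (hC.inv.re_dotProduct_pos hb).ne', RCLike.ofReal_one]
  refine ⟨⟨_, hunit, ?_⟩, Set.forall_mem_image.2 fun a ha => caponPower_le hC hb ha⟩
  beta_reduce
  rw [Matrix.mulVec_smul, mulVec_inv_mulVec hC.isUnit, dotProduct_smul, hunit, smul_eq_mul,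
    mul_one, RCLike.ofReal_re]

lemma caponPower_mono (hC : C.PosDef) (hD : D.PosDef) (hb : b ≠ 0) (hCD : (D - C).PosSemidef) :
    caponPower b C ≤ caponPower b D := by
  obtain ⟨⟨a, ha, hDa⟩, -⟩ := isLeast_caponPower hD hb
  have hdiff := hCD.re_dotProduct_nonneg a
  rw [Matrix.sub_mulVec, dotProduct_sub, map_sub, sub_nonneg] at hdiff
  exact (caponPower_le hC hb ha).trans (hdiff.trans_eq hDa)

-- A minimum of functions that are linear in `C` is concave.
lemma concaveOn_caponPower (hb : b ≠ 0) :
    ConcaveOn ℝ {C : Matrix n n 𝕜 | C.PosDef} (caponPower b) := by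
  have posDef_combo {C D : Matrix n n 𝕜} (hC : C.PosDef) (hD : D.PosDef) {s t : ℝ} (hs : 0 < s)
      (ht : 0 < t) : (s • C + t • D).PosDef := (hC.smul hs).add (hD.smul ht)
  refine concaveOn_iff_forall_pos.2 ⟨convex_iff_forall_pos.2 fun C hC D hD s t hs ht _ =>
    posDef_combo hC hD hs ht, fun C hC D hD s t hs ht _ => ?_⟩
  obtain ⟨⟨a, ha, hmin⟩, -⟩ := isLeast_caponPower (posDef_combo hC hD hs ht) hb
  calc s • caponPower b C + t • caponPower b D
      ≤ s * RCLike.re (star a ⬝ᵥ C *ᵥ a) + t * RCLike.re (star a ⬝ᵥ D *ᵥ a) := by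
        rw [smul_eq_mul, smul_eq_mul]
        gcongr
        exacts [caponPower_le hC hb ha, caponPower_le hD hb ha]
    _ = RCLike.re (star a ⬝ᵥ (s • C + t • D) *ᵥ a) := by
        simp only [Matrix.add_mulVec, Matrix.smul_mulVec, dotProduct_add, dotProduct_smul, map_add,
          RCLike.smul_re]
    _ = caponPower b (s • C + t • D) := hmin

end CaponPower

section SecondMoments

open scoped ComplexOrder

variable {𝕜 n Ω : Type*} [RCLike 𝕜] [Finite n] [MeasurableSpace Ω] {P : Measure Ω}
  {X : Ω → n → 𝕜}

lemma posSemidef_integral_mul_star (hX : ∀ i, MemLp (fun ω => X ω i) 2 P) :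
    (Matrix.of fun i j => ∫ ω, X ω i * star (X ω j) ∂P).PosSemidef := by
  have hgram : (Matrix.of fun i j => ∫ ω, X ω i * star (X ω j) ∂P) =
      Matrix.gram 𝕜 fun i => (hX i).star.toLp := by
    ext i j
    rw [Matrix.of_apply, Matrix.gram_apply, L2.inner_def]
    refine integral_congr_ae ?_
    filter_upwards [(hX i).star.coeFn_toLp, (hX j).star.coeFn_toLp] with ω hi hj
    simp [hi, hj, mul_comm]
  exact hgram ▸ Matrix.posSemidef_gram 𝕜 _

lemma integral_sub_mul_star_sub [IsProbabilityMeasure P] {Y Z : Ω → 𝕜} (hY : MemLp Y 2 P)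
    (hZ : MemLp Z 2 P) :
    ∫ ω, (Y ω - ∫ ω, Y ω ∂P) * star (Z ω - ∫ ω, Z ω ∂P) ∂P =
      ∫ ω, Y ω * star (Z ω) ∂P - (∫ ω, Y ω ∂P) * star (∫ ω, Z ω ∂P) := by
  have hY' : Integrable Y P := hY.integrable one_le_two
  have hZ' : Integrable (fun ω => star (Z ω)) P := hZ.star.integrable one_le_two
  have hstar : ∫ ω, star (Z ω) ∂P = star (∫ ω, Z ω ∂P) := integral_conj
  have hYZ : Integrable (fun ω => Y ω * star (Z ω)) P := hY.integrable_mul hZ.star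
  simp only [star_sub, sub_mul, mul_sub]
  rw [integral_sub, integral_sub hYZ (hZ'.const_mul _),
    integral_sub (hY'.mul_const _) (integrable_const _), integral_mul_const, integral_const_mul,
    hstar, integral_const, probReal_univ, one_smul, sub_self, sub_zero]
  · exact hYZ.sub (hZ'.const_mul _)
  · exact (hY'.mul_const _).sub (integrable_const _)

lemma posSemidef_integral_sub_vecMulVec [IsProbabilityMeasure P]
    (hX : ∀ i, MemLp (fun ω => X ω i) 2 P) :
    ((Matrix.of fun i j => ∫ ω, X ω i * star (X ω j) ∂P) -
      Matrix.vecMulVec (fun i => ∫ ω, X ω i ∂P) (star fun i => ∫ ω, X ω i ∂P)).PosSemidef := by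
  have hcentered := posSemidef_integral_mul_star (X := fun ω i => X ω i - ∫ ω, X ω i ∂P)
    fun i => (hX i).sub (memLp_const _)
  simp only [integral_sub_mul_star_sub (hX _) (hX _)] at hcentered
  exact hcentered

end SecondMoments

lemma integral_norm_sq_pos {Ω E : Type*} [MeasurableSpace Ω] [NormedAddCommGroup E]
    {P : Measure Ω} {X : Ω → E} (hX : MemLp X 2 P) (hX₀ : ¬X =ᵐ[P] 0) :
    0 < ∫ ω, ‖X ω‖ ^ 2 ∂P := by
  refine (integral_nonneg fun ω => by positivity).lt_of_ne' fun h => hX₀ ?_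
  filter_upwards [(integral_eq_zero_iff_of_nonneg (fun ω => by positivity)
    (hX.integrable_norm_pow two_ne_zero)).1 h] with ω hω
  simpa using hω

namespace CellFree

open scoped ComplexOrder
open NormedSpace (normalize)

section Covariance

variable {K L N : ℕ} {Ω : Type*} [MeasurableSpace Ω] {S : CellFree K L N Ω} {P : Measure Ω}
  {η η' : Fin K → ℝ} {k : Fin K}

/-- The contribution of UE `i` to `C_k(η)` per unit of its power, so that `C_k` becomes affine with
positive semidefinite coefficients; for `i = k` it is the covariance matrix of `g_kk`. -/
noncomputable def interfMat (S : CellFree K L N Ω) (P : Measure Ω) (k i : Fin K) :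
    Matrix (S.M k) (S.M k) ℂ :=
  S.corrG P k i - if i = k then Matrix.vecMulVec (S.meanG P k) (star (S.meanG P k)) else 0

lemma C_eq_sum_smul_interfMat (S : CellFree K L N Ω) (P : Measure Ω) (η : Fin K → ℝ) (k : Fin K) :
    S.C P η k = ∑ i, η i • S.interfMat P k i + S.noiseMat P k := by
  simp only [C, interfMat, smul_sub, smul_ite, smul_zero, Finset.sum_sub_distrib,
    Finset.sum_ite_eq', Finset.mem_univ, if_true, Complex.coe_smul]

lemma posSemidef_interfMat [IsProbabilityMeasure P]
    (hg : ∀ i, ∀ l : S.M k, MemLp (fun ω => S.g k i ω l) 2 P) (i : Fin K) :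
    (S.interfMat P k i).PosSemidef := by
  rw [interfMat]
  split_ifs with h
  · subst h
    exact posSemidef_integral_sub_vecMulVec (hg i)
  · rw [sub_zero]
    exact posSemidef_integral_mul_star (hg i)

lemma posSemidef_C_sub_C [IsProbabilityMeasure P]
    (hg : ∀ i, ∀ l : S.M k, MemLp (fun ω => S.g k i ω l) 2 P) (hη : η ≤ η') :
    (S.C P η' k - S.C P η k).PosSemidef := by
  have hsum : S.C P η' k - S.C P η k = ∑ i, (η' i - η i) • S.interfMat P k i := by
    simp only [C_eq_sum_smul_interfMat, add_sub_add_right_eq_sub, sub_smul,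
      Finset.sum_sub_distrib]
  exact hsum ▸ Matrix.posSemidef_sum _ fun i _ =>
    (posSemidef_interfMat hg i).smul (sub_nonneg.2 (hη i))

lemma C_smul_add_smul {s t : ℝ} (hst : s + t = 1) (η η' : Fin K → ℝ) :
    S.C P (s • η + t • η') k = s • S.C P η k + t • S.C P η' k := by
  simp only [C_eq_sum_smul_interfMat, Pi.add_apply, Pi.smul_apply, smul_eq_mul, add_smul, mul_smul,
    Finset.sum_add_distrib, smul_add, Finset.smul_sum]
  nth_rw 1 [← one_smul ℝ (S.noiseMat P k)]
  rw [← hst, add_smul]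
  abel

lemma posDef_noiseMat (hσ : 0 < S.σ) (hv : ∀ l ∈ S.M k, MemLp (S.v k l) 2 P)
    (hv0 : ∀ l ∈ S.M k, ¬S.v k l =ᵐ[P] 0) : (S.noiseMat P k).PosDef :=
  Matrix.PosDef.diagonal fun l => Complex.zero_lt_real.2 <|
    mul_pos (pow_pos hσ 2) (integral_norm_sq_pos (hv l l.2) (hv0 l l.2))

lemma posDef_C [IsProbabilityMeasure P]
    (hg : ∀ i, ∀ l : S.M k, MemLp (fun ω => S.g k i ω l) 2 P) (hF : (S.noiseMat P k).PosDef)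
    (hη : 0 ≤ η) : (S.C P η k).PosDef := by
  have hC₀ : S.C P 0 k = S.noiseMat P k := by simp [C_eq_sum_smul_interfMat]
  have hdiff := posSemidef_C_sub_C hg hη
  rw [hC₀] at hdiff
  exact sub_add_cancel (S.C P η k) _ ▸ hF.posSemidef_add hdiff

lemma isConcaveInterference_update [IsProbabilityMeasure P]
    (hg : ∀ k i, ∀ l : S.M k, MemLp (fun ω => S.g k i ω l) 2 P)
    (hF : ∀ k, (S.noiseMat P k).PosDef) (hg0 : ∀ k, S.meanG P k ≠ 0) :
    IsConcaveInterference (S.update P) where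
  monotoneOn _η hη _η' hη' h k := caponPower_mono (posDef_C (hg k) (hF k) hη)
    (posDef_C (hg k) (hF k) hη') (hg0 k) (posSemidef_C_sub_C (hg k) h)
  concaveOn := by
    refine ⟨convex_Ici 0, fun η hη η' hη' s t hs ht hst k => ?_⟩
    have hconc := (concaveOn_caponPower (hg0 k)).2 (posDef_C (hg k) (hF k) hη)
      (posDef_C (hg k) (hF k) hη') hs ht hst
    rwa [← C_smul_add_smul hst] at hconc
  zero_pos k := caponPower_pos (posDef_C (hg k) (hF k) le_rfl) (hg0 k)

end Covariance

section SINR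

variable {K L N : ℕ} {Ω : Type*} [MeasurableSpace Ω] {S : CellFree K L N Ω} {P : Measure Ω}
  {η : Fin K → ℝ} {k : Fin K}

lemma sinrOpt_eq_div_update (S : CellFree K L N Ω) (P : Measure Ω) (η : Fin K → ℝ) (k : Fin K) :
    S.sinrOpt P η k = η k / S.update P η k := by
  rw [sinrOpt, update, div_div_eq_mul_div, div_one]

lemma sinr_optLSFD (hC : (S.C P η k).PosDef) :
    S.sinr P η k (S.optLSFD P η k) = S.sinrOpt P η k := by
  have hresponse : star (S.optLSFD P η k) ⬝ᵥ S.meanG P k = S.gain P η k :=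
    star_inv_mulVec_dotProduct hC.isHermitian _
  rw [sinr, optLSFD, mulVec_inv_mulVec hC.isUnit, ← optLSFD, hresponse, Complex.ofReal_re,
    Complex.norm_real, Real.norm_eq_abs, sq_abs, sq, mul_div_assoc, mul_self_div_self, sinrOpt]

lemma sinr_le_sinrOpt (hC : (S.C P η k).PosDef) (hη : 0 ≤ η k) (a : S.M k → ℂ) :
    S.sinr P η k a ≤ S.sinrOpt P η k := by
  have hgain : 0 ≤ S.gain P η k := hC.inv.posSemidef.re_dotProduct_nonneg (S.meanG P k)
  refine div_le_of_le_mul₀ (hC.posSemidef.re_dotProduct_nonneg a) (mul_nonneg hη hgain) ?_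
  rw [sinrOpt, mul_assoc, mul_comm (S.gain P η k)]
  exact mul_le_mul_of_nonneg_left (norm_star_dotProduct_sq_le hC a (S.meanG P k)) hη

end SINR

section PowerVectors

variable {K : ℕ} {x y : Fin K → ℝ} {ρ : ℝ}

lemma mem_feasible_iff (hρ : 0 ≤ ρ) : x ∈ feasible K ρ ↔ 0 ≤ x ∧ ‖x‖ ≤ ρ := by
  refine forall_and.trans (and_congr_right fun hx => ?_)
  rw [pi_norm_le_iff_of_nonneg hρ]
  exact forall_congr' fun k => by rw [Real.norm_of_nonneg (hx k)]

variable [NeZero K]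

lemma minUE_le_minUE (h : ∀ k, ∃ j, x j ≤ y k) : minUE x ≤ minUE y :=
  Finset.le_inf' _ _ fun k _ => (h k).elim fun _j hj =>
    (Finset.inf'_le x (Finset.mem_univ _)).trans hj

lemma maxUE_eq_norm (hx : 0 ≤ x) : maxUE x = ‖x‖ := by
  have hle (k : Fin K) : x k ≤ maxUE x := Finset.le_sup' x (Finset.mem_univ k)
  refine le_antisymm (Finset.sup'_le _ _ fun k _ => (le_abs_self _).trans (norm_le_pi_norm x k)) ?_
  refine (pi_norm_le_iff_of_nonneg ((hx 0).trans (hle 0))).2 fun k => ?_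
  rw [Real.norm_of_nonneg (hx k)]
  exact hle k

lemma rescale_eq_smul_normalize (ρ : ℝ) (hx : 0 ≤ x) : rescale ρ x = ρ • normalize x := by
  ext k
  rw [rescale, maxUE_eq_norm hx, div_eq_mul_inv, mul_assoc]
  rfl

lemma iterate_eq_iterate_normalize {L N : ℕ} {Ω : Type*} [MeasurableSpace Ω]
    {S : CellFree K L N Ω} {P : Measure Ω} (hT : IsConcaveInterference (S.update P)) (hρ : 0 ≤ ρ)
    (hx : 0 ≤ x) (j : ℕ) :
    S.iterate P ρ x j = (fun η => ρ • normalize (S.update P η))^[j] x := by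
  have hmaps : Set.MapsTo (fun η => ρ • normalize (S.update P η)) (Set.Ici 0) (Set.Ici 0) :=
    fun η hη => hT.normalize_apply_nonneg hρ hη
  induction j with
  | zero => rfl
  | succ j ih =>
    have hj : 0 ≤ S.iterate P ρ x j := ih ▸ hmaps.iterate j hx
    rw [iterate, rescale_eq_smul_normalize ρ fun k => (hT.apply_pos hj k).le, ih,
      Function.iterate_succ_apply']

end PowerVectors

end CellFree

theorem lemma2 {K L N : ℕ} [NeZero K] {Ω : Type*} [MeasurableSpace Ω]
    (P : Measure Ω) [IsProbabilityMeasure P] (S : CellFree K L N Ω) (ρ : ℝ)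
    (hσ : 0 < S.σ) (hρ : 0 < ρ)
    (hv : ∀ k, ∀ l ∈ S.M k, MemLp (S.v k l) 2 P)
    (hg : ∀ k i, ∀ l : S.M k, MemLp (fun ω => S.g k i ω l) 2 P)
    (hv0 : ∀ k, ∀ l ∈ S.M k, ¬ S.v k l =ᵐ[P] 0)
    (hg0 : ∀ k, S.meanG P k ≠ 0) :
    ∃ ηs : Fin K → ℝ,
      ηs ∈ CellFree.feasible K ρ ∧
      IsMaxOn (fun η => CellFree.minUE (S.sinrOpt P η)) (CellFree.feasible K ρ) ηs ∧
      (∀ η ∈ CellFree.feasible K ρ, ∀ a : (k : Fin K) → S.M k → ℂ,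
        CellFree.minUE (fun k => S.sinr P η k (a k)) ≤
          CellFree.minUE (fun k => S.sinr P ηs k (S.optLSFD P ηs k))) ∧
      ∀ η₀ : Fin K → ℝ, (∀ k, 0 < η₀ k) →
        Tendsto (S.iterate P ρ η₀) atTop (𝓝 ηs) := by
  have hF k := CellFree.posDef_noiseMat hσ (hv k) (hv0 k)
  have hC {η : Fin K → ℝ} (hη : 0 ≤ η) k := CellFree.posDef_C (hg k) (hF k) hη
  have hT := CellFree.isConcaveInterference_update hg hF hg0
  obtain ⟨z, hz, hfix, hconv⟩ := hT.exists_fixedPoint_normalize hρ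
  have hopt {η : Fin K → ℝ} (hη : η ∈ CellFree.feasible K ρ) :
      ∃ j, ∀ k, S.sinrOpt P η j ≤ S.sinrOpt P z k := by
    obtain ⟨hη₀, hηρ⟩ := (CellFree.mem_feasible_iff hρ.le).1 hη
    simp only [CellFree.sinrOpt_eq_div_update, hT.div_apply_of_normalize_eq hz hfix, forall_const]
    exact hT.exists_div_apply_le hρ hz hfix hη₀ hηρ
  refine ⟨z, (CellFree.mem_feasible_iff hρ.le).2 ⟨hz, ?_⟩, fun η hη => ?_, fun η hη a => ?_,
    fun η₀ hη₀ => ?_⟩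
  · exact (congrArg norm hfix).ge.trans (hT.norm_normalize_apply hρ.le hz).le
  · exact CellFree.minUE_le_minUE fun k => (hopt hη).imp fun _ hj => hj k
  · refine CellFree.minUE_le_minUE fun k => (hopt hη).imp fun j hj => ?_
    rw [CellFree.sinr_optLSFD (hC hz k)]
    exact (CellFree.sinr_le_sinrOpt (hC (fun i => (hη i).1) j) (hη j).1 (a j)).trans (hj k)
  · exact (hconv η₀ fun k => (hη₀ k).le).congr fun j =>
      (CellFree.iterate_eq_iterate_normalize hT hρ.le (fun k => (hη₀ k).le) j).symm
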